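/- Let $M$ be a smooth $n$-dimensional manifold (without boundary, Hausdorff, second countable) and let $g(t)$, $0\le t<\infty$, be smooth Riemannian metrics on $M$ forming a gradient Ricci soliton with potential $f$; that is, for some constant $\rho\in\mathbb R$ (steady if $\rho=0$, expanding if $\rho>0$, shrinking if $\rho<0$), $$\frac{\partial}{\partial t}g(t)=-2\,\mathrm{Ric}(g(t))-2\rho\, g(t)\qquad (0\le t<\infty),$$ $f:M\to\mathbb R$ is smooth, and there are diffeomorphisms $\varphi_t$ of $M$, $t\ge 0$, generated by $-\nabla f$ (gradient with respect to $g(0)$), i.e. $\varphi_0=\mathrm{id}$ and $\frac{d}{dt}\varphi_t(x)=-\nabla f(\varphi_t(x))$ for all $x\in M$ and $t\ge0$, such that $g(t)=\varphi_t^*g(0)$ for all $t\ge 0$. Suppose the flow $\varphi_t$ has an equilibrium point $p$, i.e. $\varphi_t(p)=p$ for all $t\ge 0$. Suppose moreover that there are a sequence of times $t_k\to\infty$, positive numbers $\sigma_k$, a neighborhood $U$ of $p$ and a continuous Riemannian metric $h$ on $U$ such that $\sigma_k\, g(t_k)\to h$ uniformly on $U$ (norms of tensors being taken with respect to $g(0)$: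 for every $\varepsilon>0$ and all sufficiently large $k$, $|\sigma_k g(t_k)(v,w)-h(v,w)|\le\varepsilon\,|v|_{g(0)}|w|_{g(0)}$ for all $x\in U$ and $v,w\in T_xM$). Then there is a constant $\beta\in\mathbb R$ such that $\mathrm{Ric}(g(0))=\beta\, g(0)$ at the point $p$. -/

import Mathlib

open Set Filter
open scoped Manifold ContDiff Topology

noncomputable section

namespace RicciSoliton

/-- Smooth Riemannian metrics on a smooth `n`-manifold `M` without boundary. -/
abbrev Metric (n : ℕ) (M : Type*) [TopologicalSpace M]
    [ChartedSpace (EuclideanSpace ℝ (Fin n)) M] [IsManifold (𝓡 n) ∞ M] :=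
  Bundle.ContMDiffRiemannianMetric (𝓡 n) ∞ (EuclideanSpace ℝ (Fin n))
    (fun x : M => TangentSpace (𝓡 n) x)

section Coordinates

/-! ### The Ricci tensor of a metric on (an open subset of) `ℝⁿ`

Here `G` is the matrix `(g_ij)` of a metric as a function of the coordinates. -/

variable {n : ℕ}

/-- The partial derivative `∂_i u` at `y`. -/
def partialDeriv (i : Fin n) (u : EuclideanSpace ℝ (Fin n) → ℝ)
    (y : EuclideanSpace ℝ (Fin n)) : ℝ :=
  fderiv ℝ u y (EuclideanSpace.single i 1)

/-- The Christoffel symbols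
`Γ^k_ij = ½ ∑_l g^{kl} (∂_i g_jl + ∂_j g_il - ∂_l g_ij)`. -/
def christoffel (G : EuclideanSpace ℝ (Fin n) → Matrix (Fin n) (Fin n) ℝ) (k i j : Fin n)
    (y : EuclideanSpace ℝ (Fin n)) : ℝ :=
  (1 / 2) * ∑ l, (G y)⁻¹ k l *
    (partialDeriv i (fun z => G z j l) y + partialDeriv j (fun z => G z i l) y
      - partialDeriv l (fun z => G z i j) y)

/-- The components of the Ricci tensor,
`R_ij = ∑_k (∂_k Γ^k_ij - ∂_j Γ^k_ik) + ∑_{k,l} (Γ^k_kl Γ^l_ij - Γ^k_jl Γ^l_ik)`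
(the sign for which round spheres have positive Ricci curvature). -/
def coordRicci (G : EuclideanSpace ℝ (Fin n) → Matrix (Fin n) (Fin n) ℝ) (i j : Fin n)
    (y : EuclideanSpace ℝ (Fin n)) : ℝ :=
  ∑ k, (partialDeriv k (christoffel G k i j) y - partialDeriv j (christoffel G k i k) y)
    + ∑ k, ∑ l, (christoffel G k k l y * christoffel G l i j y
        - christoffel G k j l y * christoffel G l i k y)

end Coordinates

/-- The differential at `y` of the inverse of the preferred chart at `x`. It maps the `i`-th
standard basis vector to the coordinate field `∂_i`. -/
def chartInvDeriv {E : Type*} [NormedAddCommGroup E] [NormedSpace ℝ E] {M : Type*}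
    [TopologicalSpace M] [ChartedSpace E M] (x : M) (y : E) :
    E →L[ℝ] TangentSpace 𝓘(ℝ, E) ((extChartAt 𝓘(ℝ, E) x).symm y) :=
  mfderiv 𝓘(ℝ, E) 𝓘(ℝ, E) (extChartAt 𝓘(ℝ, E) x).symm y

variable {n : ℕ} {M : Type*} [TopologicalSpace M] [ChartedSpace (EuclideanSpace ℝ (Fin n)) M]
  [IsManifold (𝓡 n) ∞ M]

/-- The components `g_ij = g(∂_i, ∂_j)` of the metric `g` in the preferred chart at `x`, as
functions of the coordinates. -/
def chartMatrix (g : Metric n M) (x : M) (y : EuclideanSpace ℝ (Fin n)) :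
    Matrix (Fin n) (Fin n) ℝ :=
  Matrix.of fun i j =>
    g.inner ((extChartAt (𝓡 n) x).symm y)
      (chartInvDeriv x y (EuclideanSpace.single i 1))
      (chartInvDeriv x y (EuclideanSpace.single j 1))

/-- The Ricci tensor `Ric_g(v, w) = ∑_ij R_ij v^i w^j` at `x`, computed in the preferred chart
at `x`. In Mathlib a vector in `TangentSpace (𝓡 n) x` is, by definition, the tuple of its
coordinates in the preferred chart at `x`, so these are the numbers `v i`. -/
def ricci (g : Metric n M) (x : M) (v w : TangentSpace (𝓡 n) x) : ℝ :=
  let a : EuclideanSpace ℝ (Fin n) := v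
  let b : EuclideanSpace ℝ (Fin n) := w
  ∑ i, ∑ j, coordRicci (chartMatrix g x) i j (extChartAt (𝓡 n) x x) * a i * b j

instance (x : M) : FiniteDimensional ℝ (TangentSpace (𝓡 n) x) :=
  inferInstanceAs (FiniteDimensional ℝ (EuclideanSpace ℝ (Fin n)))

/-- The metric at a point, as an algebraic bilinear form. -/
def bilinAt (g : Metric n M) (x : M) : LinearMap.BilinForm ℝ (TangentSpace (𝓡 n) x) :=
  (ContinuousLinearMap.coeLM ℝ).comp (g.inner x).toLinearMap

theorem bilinAt_nondegenerate (g : Metric n M) (x : M) : (bilinAt g x).Nondegenerate := by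
  refine ⟨fun v hv => ?_, fun v hv => ?_⟩
  · by_contra h
    exact (g.pos x v h).ne' (hv v)
  · by_contra h
    exact (g.pos x v h).ne' (hv v)

/-- The gradient of `f` with respect to `g`: the vector field with `g(∇f, w) = df(w)`. -/
def grad (g : Metric n M) (f : M → ℝ) (x : M) : TangentSpace (𝓡 n) x :=
  ((bilinAt g x).toDual (bilinAt_nondegenerate g x)).symm
    (mfderiv (𝓡 n) 𝓘(ℝ, ℝ) f x).toLinearMap

theorem inner_grad (g : Metric n M) (f : M → ℝ) (x : M) (w : TangentSpace (𝓡 n) x) :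
    g.inner x (grad g f x) w = mfderiv (𝓡 n) 𝓘(ℝ, ℝ) f x w :=
  LinearMap.BilinForm.apply_toDual_symm_apply (hB := bilinAt_nondegenerate g x)
    (mfderiv (𝓡 n) 𝓘(ℝ, ℝ) f x).toLinearMap w

/-- `g(t)`, `0 ≤ t < ∞`, is a gradient Ricci soliton with constant `ρ`, potential `f` and
diffeomorphisms `φ_t` generated by `-∇f`, the gradient being taken with respect to `g(0)`. It is
of steady, expanding or shrinking type according to `ρ = 0`, `ρ > 0` or `ρ < 0`.
Values of `g` and `φ` at negative times are irrelevant. -/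
structure IsGradientRicciSoliton (g : ℝ → Metric n M) (ρ : ℝ) (f : M → ℝ)
    (φ : ℝ → M ≃ₘ⟮𝓡 n, 𝓡 n⟯ M) : Prop where
  /-- The Ricci flow equation `∂g/∂t = -2 Ric - 2ρ g` on `[0, ∞)` (one-sided at `t = 0`). -/
  ricci_flow : ∀ t : ℝ, 0 ≤ t → ∀ (x : M) (v w : TangentSpace (𝓡 n) x),
    HasDerivWithinAt (fun s => (g s).inner x v w)
      (-2 * ricci (g t) x v w - 2 * ρ * (g t).inner x v w) (Ici 0) t
  /-- The potential is smooth. -/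
  smooth_potential : ContMDiff (𝓡 n) 𝓘(ℝ, ℝ) ∞ f
  /-- The family `φ_t` starts at the identity. -/
  flow_zero : ∀ x : M, φ 0 x = x
  /-- Each `t ↦ φ_t(x)` is an integral curve of `-∇f`. -/
  flow : ∀ x : M, IsMIntegralCurveOn (fun t => φ t x) (fun y => -grad (g 0) f y) (Ici 0)
  /-- `g(t)` is the pull-back `φ_t^* g(0)`. -/
  pullback : ∀ t : ℝ, 0 ≤ t → ∀ (x : M) (v w : TangentSpace (𝓡 n) x),
    (g t).inner x v w =
      (g 0).inner (φ t x) (mfderiv (𝓡 n) (𝓡 n) (φ t) x v) (mfderiv (𝓡 n) (𝓡 n) (φ t) x w)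

/-- `h` is a (continuous) Riemannian metric on the subset `U` of `M`. -/
structure IsRiemannianMetricOn
    (h : ∀ x : M, TangentSpace (𝓡 n) x →L[ℝ] TangentSpace (𝓡 n) x →L[ℝ] ℝ) (U : Set M) :
    Prop where
  symm : ∀ x ∈ U, ∀ v w : TangentSpace (𝓡 n) x, h x v w = h x w v
  pos : ∀ x ∈ U, ∀ v : TangentSpace (𝓡 n) x, v ≠ 0 → 0 < h x v v
  continuousOn : ContinuousOn
    (fun x => Bundle.TotalSpace.mk'
      (EuclideanSpace ℝ (Fin n) →L[ℝ] EuclideanSpace ℝ (Fin n) →L[ℝ] ℝ)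
      (E := fun x : M => TangentSpace (𝓡 n) x →L[ℝ] TangentSpace (𝓡 n) x →L[ℝ] ℝ) x (h x)) U

/-- The 2-tensors `a k` converge to `h` uniformly on `U`, the size of a 2-tensor at a point being
measured by the fixed metric `g₀`: for every `ε > 0`, for all large `k`,
`|(a k - h)(v, w)| ≤ ε |v| |w|` at all points of `U`. -/
def TendstoUniformlyOnSet (g₀ : Metric n M)
    (a : ℕ → ∀ x : M, TangentSpace (𝓡 n) x →L[ℝ] TangentSpace (𝓡 n) x →L[ℝ] ℝ)
    (h : ∀ x : M, TangentSpace (𝓡 n) x →L[ℝ] TangentSpace (𝓡 n) x →L[ℝ] ℝ) (U : Set M) : Prop :=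
  ∀ ε : ℝ, 0 < ε → ∀ᶠ k in atTop, ∀ x ∈ U, ∀ v w : TangentSpace (𝓡 n) x,
    |a k x v w - h x v w| ≤ ε * Real.sqrt (g₀.inner x v v) * Real.sqrt (g₀.inner x w w)

end RicciSoliton

end

/-! Let `L` be the linearization of `-∇f` at `p`. Since `∇f` vanishes at `p`, the form `g(0)(L·,·)`
is minus the second derivative of `f` there, so `L` is `g(0)`-symmetric and hence diagonalizable
(`exists_hasFDerivAt_gradInChart`). The differential of `φ_t` at `p` multiplies an eigenvector of
`L` with eigenvalue `c` by `exp (c t)` (`fderiv_flow_apply_eigenvector`), so by pull-back `g(t)(v,v)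
= exp (2ct) g(0)(v,v)` at `p`. Rescaling by `σ_k` must give a positive limit along every
eigenvector, and one sequence `σ_k` cannot balance two different exponential rates. Hence `L` is a
scalar `c` and `g(t) = exp (2ct) g(0)` at `p`; differentiating at `t = 0` and comparing with the
flow equation gives `Ric = (-c - ρ) g(0)`.

Joint smoothness of `(t, x) ↦ φ_t(x)` is not assumed, so the differential of `φ_t` is found by
Grönwall estimates on nearby trajectories rather than from the variational equation. -/

noncomputable section

namespace RicciSoliton

/-! ### Symmetric maps with a single eigenvalue -/

/-- A linear map that is symmetric for a positive definite bilinear form and has at most one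
eigenvalue is a scalar. -/
theorem exists_eq_smul_of_symmetric_of_unique_eigenvalue {V : Type*} [AddCommGroup V] [Module ℝ V]
    [FiniteDimensional ℝ V] (B : V →ₗ[ℝ] V →ₗ[ℝ] ℝ) (hsymm : ∀ v w, B v w = B w v)
    (hpos : ∀ v, v ≠ 0 → 0 < B v v) (T : V →ₗ[ℝ] V) (hT : ∀ v w, B (T v) w = B v (T w))
    (hev : ∀ (a b : ℝ) (v w : V), v ≠ 0 → w ≠ 0 → T v = a • v → T w = b • w → a = b) :
    ∃ c : ℝ, ∀ v, T v = c • v := by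
  -- `B` itself becomes the inner product, so that the spectral theorem applies to `T`.
  let core : InnerProductSpace.Core ℝ V :=
    { inner := fun v w => B v w
      conj_inner_symm := fun v w => by simpa using hsymm w v
      re_inner_nonneg := fun v => by
        by_cases hv : v = 0
        · simp [hv]
        · simpa using (hpos v hv).le
      add_left := fun u v w => by simp
      smul_left := fun u v r => by simp
      definite := fun v hv => by
        by_contra h
        exact (hpos v h).ne' hv }
  let : NormedAddCommGroup V := core.toNormedAddCommGroup
  let : InnerProductSpace ℝ V := InnerProductSpace.ofCore core.toCore
  have hsym : T.IsSymmetric := fun v w => hT v w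
  have htop : (⨆ a, Module.End.eigenspace T a) = ⊤ := by
    rw [← Submodule.orthogonal_eq_bot_iff]
    exact hsym.orthogonalComplement_iSup_eigenspaces_eq_bot
  by_cases h : ∃ (c : ℝ) (v : V), v ≠ 0 ∧ T v = c • v
  · obtain ⟨c, v, hv, hc⟩ := h
    refine ⟨c, fun w => ?_⟩
    have hle : (⨆ a, Module.End.eigenspace T a) ≤ Module.End.eigenspace T c := by
      refine iSup_le fun a u hu => ?_
      rw [Module.End.mem_eigenspace_iff] at hu ⊢
      by_cases hu0 : u = 0
      · simp [hu0]
      · rw [hu, hev a c u v hu0 hv hu hc]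
    have hw : w ∈ Module.End.eigenspace T c := hle (htop ▸ Submodule.mem_top)
    exact Module.End.mem_eigenspace_iff.1 hw
  -- Without eigenvectors the spanning eigenspaces are all zero, so `V = 0` and any scalar works.
  · push Not at h
    refine ⟨0, fun w => ?_⟩
    have hle : (⨆ a, Module.End.eigenspace T a) ≤ ⊥ := by
      refine iSup_le fun a u hu => ?_
      rw [Module.End.mem_eigenspace_iff] at hu
      by_contra hu0
      exact h a u hu0 hu
    have hw : w = 0 := by simpa using hle (htop ▸ Submodule.mem_top : w ∈ _)
    simp [hw]

/-! ### Confinement to a coordinate ball -/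

/-- A continuous curve that cannot reach the boundary of a closed coordinate ball while it stays in
the interior of the ball never leaves that interior. -/
theorem mem_coordinate_ball_of_forall_Ico {M : Type*} [TopologicalSpace M] [T2Space M]
    {F : Type*} [PseudoMetricSpace F]
    [ProperSpace F] (e : OpenPartialHomeomorph M F) {x₀ : F}
    {r T : ℝ} (hr : Metric.closedBall x₀ r ⊆ e.target) {γ : ℝ → M}
    (hγ : ContinuousOn γ (Icc 0 T)) (h0 : γ 0 ∈ e.source ∩ e ⁻¹' Metric.ball x₀ r)
    (hstep : ∀ s ∈ Icc 0 T, (∀ t ∈ Ico 0 s, γ t ∈ e.source ∩ e ⁻¹' Metric.ball x₀ r) →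
      γ s ∈ e.source → e (γ s) ∈ Metric.ball x₀ r) :
    ∀ t ∈ Icc 0 T, γ t ∈ e.source ∩ e ⁻¹' Metric.ball x₀ r := by
  set W := e.source ∩ e ⁻¹' Metric.ball x₀ r with hW
  have hWo : IsOpen W := e.isOpen_inter_preimage Metric.isOpen_ball
  by_contra! hcon
  obtain ⟨t₁, ht₁, hbad⟩ := hcon
  have hclosed : IsClosed (Icc 0 T ∩ γ ⁻¹' Wᶜ) :=
    hγ.preimage_isClosed_of_isClosed isClosed_Icc hWo.isClosed_compl
  have hcomp : IsCompact (Icc 0 T ∩ γ ⁻¹' Wᶜ) :=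
    isCompact_Icc.of_isClosed_subset hclosed inter_subset_left
  obtain ⟨s, ⟨hsT, hsW⟩, hmin⟩ := hcomp.exists_isLeast ⟨t₁, ht₁, hbad⟩
  have hbefore : ∀ t ∈ Ico 0 s, γ t ∈ W := fun t ht => by
    by_contra hn
    exact absurd (hmin ⟨⟨ht.1, ht.2.le.trans hsT.2⟩, hn⟩) (not_le.2 ht.2)
  have hs0 : 0 < s := by
    rcases hsT.1.eq_or_lt with h | h
    · exact absurd (h ▸ h0) hsW
    · exact h
  -- In a Hausdorff space this compact set is closed, so the first exit point `γ s`, a limit of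
  -- points of `W`, still lies in the chart domain.
  have hK : IsCompact (e.symm '' Metric.closedBall x₀ r) :=
    (isCompact_closedBall x₀ r).image_of_continuousOn (e.continuousOn_symm.mono hr)
  have hWK : W ⊆ e.symm '' Metric.closedBall x₀ r := fun q hq =>
    ⟨e q, Metric.ball_subset_closedBall hq.2, e.left_inv hq.1⟩
  have hmem : γ s ∈ closure W := by
    have h1 : ContinuousWithinAt γ (Ico 0 s) s :=
      (hγ s hsT).mono fun t ht => ⟨ht.1, ht.2.le.trans hsT.2⟩
    refine h1.mem_closure ?_ hbefore
    rw [closure_Ico hs0.ne]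
    exact ⟨hs0.le, le_rfl⟩
  obtain ⟨y, hy, hys⟩ := closure_minimal hWK hK.isClosed hmem
  have hsrc : γ s ∈ e.source := hys ▸ e.map_target (hr hy)
  exact hsW ⟨hsrc, hstep s hsT hbefore hsrc⟩

/-! ### Grönwall estimates and the differential of a flow at an equilibrium -/

section ODE

variable {E : Type*} [NormedAddCommGroup E] [NormedSpace ℝ E]

/-- Growth of a solution of an almost linear differential equation. -/
theorem norm_le_of_deriv_approx_linear {L : E →L[ℝ] E} {δ T : ℝ} {z z' : ℝ → E}
    (hz : ContinuousOn z (Icc 0 T))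
    (hz' : ∀ t ∈ Ico 0 T, HasDerivWithinAt z (z' t) (Ici t) t)
    (hb : ∀ t ∈ Ico 0 T, ‖z' t - L (z t)‖ ≤ δ * ‖z t‖) :
    ∀ t ∈ Icc 0 T, ‖z t‖ ≤ ‖z 0‖ * Real.exp ((‖L‖ + δ) * t) := by
  intro t ht
  have := norm_le_gronwallBound_of_norm_deriv_right_le (K := ‖L‖ + δ) (ε := 0) hz hz' le_rfl
    (fun s hs => ?_) t ht
  · simpa [gronwallBound_ε0] using this
  · calc ‖z' s‖ = ‖(z' s - L (z s)) + L (z s)‖ := by simp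
      _ ≤ ‖z' s - L (z s)‖ + ‖L (z s)‖ := norm_add_le _ _
      _ ≤ δ * ‖z s‖ + ‖L‖ * ‖z s‖ := add_le_add (hb s hs) (L.le_opNorm _)
      _ = (‖L‖ + δ) * ‖z s‖ + 0 := by ring

/-- Used to pull `δ * ‖z 0‖` out of the Grönwall bound, so that the error is a small multiple of the
initial displacement. -/
theorem gronwallBound_zero_mul (a K ε x : ℝ) :
    gronwallBound 0 K (a * ε) x = a * gronwallBound 0 K ε x := by
  unfold gronwallBound
  split_ifs <;> ring

/-- A solution of an almost linear differential equation starting at an eigenvector stays close to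
the solution of the linear equation. -/
theorem norm_sub_exp_smul_le {L : E →L[ℝ] E} {δ T c : ℝ} (hδ : 0 ≤ δ) (hT : 0 ≤ T)
    {z z' : ℝ → E} (hz : ContinuousOn z (Icc 0 T))
    (hz' : ∀ t ∈ Ico 0 T, HasDerivWithinAt z (z' t) (Ici t) t)
    (hb : ∀ t ∈ Ico 0 T, ‖z' t - L (z t)‖ ≤ δ * ‖z t‖) (hc : L (z 0) = c • z 0) :
    ‖z T - Real.exp (c * T) • z 0‖ ≤
      δ * gronwallBound 0 ‖L‖ (Real.exp ((‖L‖ + δ) * T)) T * ‖z 0‖ := by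
  have hgrow := norm_le_of_deriv_approx_linear hz hz' hb
  have hexp : ∀ t : ℝ, HasDerivAt (fun s => Real.exp (c * s) • z 0)
      ((Real.exp (c * t) * c) • z 0) t := fun t => by
    have h1 : HasDerivAt (fun s : ℝ => Real.exp (c * s)) (Real.exp (c * t) * c) t := by
      simpa using ((hasDerivAt_id t).const_mul c).exp
    exact h1.smul_const _
  -- The difference from the linear solution starts at zero and is driven only by the error `δ * ‖z
  -- t‖`, which the growth bound at time `T` controls.
  have := norm_le_gronwallBound_of_norm_deriv_right_le
    (f := fun t => z t - Real.exp (c * t) • z 0)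
    (f' := fun t => z' t - (Real.exp (c * t) * c) • z 0) (δ := 0) (K := ‖L‖)
    (ε := (δ * ‖z 0‖) * Real.exp ((‖L‖ + δ) * T)) (a := 0) (b := T)
    (hz.sub (by fun_prop)) (fun t ht => (hz' t ht).sub (hexp t).hasDerivWithinAt) (by simp)
    (fun t ht => ?_) T ⟨hT, le_rfl⟩
  · rw [gronwallBound_zero_mul, sub_zero] at this
    exact this.trans_eq (by ring)
  · have hL : (Real.exp (c * t) * c) • z 0 = L (Real.exp (c * t) • z 0) := by
      rw [map_smul, hc, smul_smul]
    calc ‖z' t - (Real.exp (c * t) * c) • z 0‖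
        = ‖(z' t - L (z t)) + L (z t - Real.exp (c * t) • z 0)‖ := by rw [hL, map_sub]; congr 1; abel
      _ ≤ ‖z' t - L (z t)‖ + ‖L (z t - Real.exp (c * t) • z 0)‖ := norm_add_le _ _
      _ ≤ δ * ‖z t‖ + ‖L‖ * ‖z t - Real.exp (c * t) • z 0‖ :=
        add_le_add (hb t ht) (L.le_opNorm _)
      _ ≤ ‖L‖ * ‖z t - Real.exp (c * t) • z 0‖ + (δ * ‖z 0‖) * Real.exp ((‖L‖ + δ) * T) := by
        have h2 : ‖z t‖ ≤ ‖z 0‖ * Real.exp ((‖L‖ + δ) * T) :=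
          (hgrow t ⟨ht.1, ht.2.le⟩).trans (by gcongr; exact ht.2.le)
        have := mul_le_mul_of_nonneg_left h2 hδ
        linarith

variable {M : Type*} [TopologicalSpace M] [T2Space M]

/-- Near an equilibrium, a flow agrees to first order, along eigendirections of the linearization
of the generating vector field, with the linear flow. Here `X` is the vector field in the
coordinates `e`. -/
theorem eventually_norm_flow_sub_exp_smul_le [ProperSpace E] (e : OpenPartialHomeomorph M E)
    {x₀ : E} (hx₀ : x₀ ∈ e.target) {Φ : ℝ → M → M} (hΦ0 : ∀ x, Φ 0 x = x)
    (hΦ : ∀ x, ContinuousOn (fun t => Φ t x) (Ici 0)) {X : E → E} {L : E →L[ℝ] E}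
    (hX : HasFDerivAt X L x₀) (hX0 : X x₀ = 0)
    (hflow : ∀ x, ∀ t ∈ Ici (0 : ℝ), Φ t x ∈ e.source →
      HasDerivWithinAt (fun s => e (Φ s x)) (X (e (Φ t x))) (Ici 0) t)
    {T : ℝ} (hT : 0 ≤ T) (c : ℝ) {η : ℝ} (hη : 0 < η) :
    ∀ᶠ y in 𝓝 x₀, L (y - x₀) = c • (y - x₀) →
      ‖e (Φ T (e.symm y)) - x₀ - Real.exp (c * T) • (y - x₀)‖ ≤ η * ‖y - x₀‖ := by
  obtain ⟨δ, hδ0, hδη⟩ : ∃ δ : ℝ, 0 < δ ∧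
      δ * gronwallBound 0 ‖L‖ (Real.exp ((‖L‖ + δ) * T)) T ≤ η := by
    have hcont : Continuous fun δ : ℝ =>
        δ * gronwallBound 0 ‖L‖ (Real.exp ((‖L‖ + δ) * T)) T :=
      continuous_id.mul ((gronwallBound_continuous_ε 0 ‖L‖ T).comp (by fun_prop))
    have hev : ∀ᶠ δ in 𝓝 (0 : ℝ), δ * gronwallBound 0 ‖L‖ (Real.exp ((‖L‖ + δ) * T)) T < η :=
      hcont.continuousAt.eventually_lt continuousAt_const (by simpa using hη)
    obtain ⟨δ, hδ, h⟩ := ((hev.filter_mono nhdsWithin_le_nhds).and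
      (self_mem_nhdsWithin : Ioi (0 : ℝ) ∈ 𝓝[>] 0)).exists
    exact ⟨δ, h, hδ.le⟩
  obtain ⟨r, hr0, hr⟩ : ∃ r > 0, ∀ y ∈ Metric.closedBall x₀ r,
      y ∈ e.target ∧ ‖X y - L (y - x₀)‖ ≤ δ * ‖y - x₀‖ := by
    have h1 := (hasFDerivAt_iff_isLittleO.1 hX).def hδ0
    simp only [hX0, sub_zero] at h1
    have h2 := (eventually_mem_set.2 (e.open_target.mem_nhds hx₀)).and h1
    obtain ⟨r, hr0, hr⟩ := Metric.nhds_basis_closedBall.mem_iff.1 h2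
    exact ⟨r, hr0, hr⟩
  -- Start so close to `x₀` that growth over `[0, T]` cannot reach radius `r`.
  have hsmall : ∀ᶠ y in 𝓝 x₀, ‖y - x₀‖ * Real.exp ((‖L‖ + δ) * T) < r := by
    have hcont : Continuous fun y : E => ‖y - x₀‖ * Real.exp ((‖L‖ + δ) * T) := by fun_prop
    exact hcont.continuousAt.eventually_lt continuousAt_const (by simpa using hr0)
  filter_upwards [hsmall, Metric.ball_mem_nhds x₀ hr0] with y hy hyr hc
  have hyt : y ∈ e.target := (hr y (Metric.ball_subset_closedBall hyr)).1
  set γ : ℝ → M := fun t => Φ t (e.symm y) with hγdef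
  have hγ : ContinuousOn γ (Ici 0) := hΦ _
  have hγ0 : e (γ 0) = y := by simp [hγdef, hΦ0, e.right_inv hyt]
  have hz : ∀ s, 0 ≤ s → (∀ t ∈ Icc 0 s, γ t ∈ e.source) →
      ContinuousOn (fun t => e (γ t) - x₀) (Icc 0 s) := fun s _ hs =>
    (e.continuousOn.comp (hγ.mono Icc_subset_Ici_self) hs).sub continuousOn_const
  have hz' : ∀ t, 0 ≤ t → γ t ∈ e.source →
      HasDerivWithinAt (fun s => e (γ s) - x₀) (X (e (γ t))) (Ici t) t := fun t ht hs =>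
    ((hflow _ t ht hs).mono (Ici_subset_Ici.2 ht)).sub_const _
  have hstay := mem_coordinate_ball_of_forall_Ico e (fun y hy => (hr y hy).1)
    (hγ.mono (Icc_subset_Ici_self : Icc 0 T ⊆ Ici 0)) (r := r)
    ⟨by simpa [hγdef, hΦ0] using e.map_target hyt, by simpa [hγ0] using hyr⟩
    (fun s hs hbef hsrc => by
      have hsrc' : ∀ t ∈ Icc 0 s, γ t ∈ e.source := fun t ht => by
        rcases ht.2.eq_or_lt with h | h
        · exact h ▸ hsrc
        · exact (hbef t ⟨ht.1, h⟩).1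
      have hn := norm_le_of_deriv_approx_linear (L := L) (δ := δ) (hz s hs.1 hsrc')
        (fun t ht => hz' t ht.1 (hbef t ht).1)
        (fun t ht => (hr _ (Metric.ball_subset_closedBall (hbef t ht).2)).2) s ⟨hs.1, le_rfl⟩
      rw [mem_ball_iff_norm]
      rw [hγ0] at hn
      refine (hn.trans ?_).trans_lt hy
      gcongr
      exact hs.2)
  have := norm_sub_exp_smul_le (L := L) hδ0.le hT (hz T hT fun t ht => (hstay t ht).1)
    (fun t ht => hz' t ht.1 (hstay t ⟨ht.1, ht.2.le⟩).1)
    (fun t ht => (hr _ (Metric.ball_subset_closedBall (hstay t ⟨ht.1, ht.2.le⟩).2)).2)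
    (c := c) (by rw [hγ0]; exact hc)
  rw [hγ0] at this
  exact this.trans (by gcongr)

/-- The differential at an equilibrium of the time `T` map of a flow acts on an eigenvector of the
linearization of the generating vector field, for the eigenvalue `c`, as `exp (c T)`. -/
theorem fderiv_flow_apply_eigenvector [ProperSpace E] (e : OpenPartialHomeomorph M E)
    {x₀ : E} (hx₀ : x₀ ∈ e.target) {Φ : ℝ → M → M} (hΦ0 : ∀ x, Φ 0 x = x)
    (hΦ : ∀ x, ContinuousOn (fun t => Φ t x) (Ici 0)) {X : E → E} {L : E →L[ℝ] E}
    (hX : HasFDerivAt X L x₀) (hX0 : X x₀ = 0)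
    (hflow : ∀ x, ∀ t ∈ Ici (0 : ℝ), Φ t x ∈ e.source →
      HasDerivWithinAt (fun s => e (Φ s x)) (X (e (Φ t x))) (Ici 0) t)
    {T : ℝ} (hT : 0 ≤ T) {A : E →L[ℝ] E}
    (hA : HasFDerivAt (fun y => e (Φ T (e.symm y))) A x₀) {c : ℝ} {v : E} (hv : L v = c • v) :
    A v = Real.exp (c * T) • v := by
  have hest := fun {η : ℝ} (hη : 0 < η) =>
    eventually_norm_flow_sub_exp_smul_le e hx₀ hΦ0 hΦ hX hX0 hflow hT c hη
  have hline : Tendsto (fun ε : ℝ => x₀ + ε • v) (𝓝 0) (𝓝 x₀) := by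
    have : Continuous fun ε : ℝ => x₀ + ε • v := by fun_prop
    simpa using this.tendsto 0
  -- At `y = x₀` the eigenvector condition is trivial and the bound is zero.
  have hfix : e (Φ T (e.symm x₀)) = x₀ := by
    have := (hest one_pos).self_of_nhds (by simp)
    simpa [sub_eq_zero] using this
  have h1 : HasDerivAt (fun ε : ℝ => e (Φ T (e.symm (x₀ + ε • v)))) (A v) 0 := by
    have h2 : HasDerivAt (fun ε : ℝ => x₀ + ε • v) v 0 := by
      simpa using ((hasDerivAt_id (0 : ℝ)).smul_const v).const_add x₀
    have hA' : HasFDerivAt (fun y => e (Φ T (e.symm y))) A (x₀ + (0 : ℝ) • v) := by simpa using hA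
    exact hA'.comp_hasDerivAt (0 : ℝ) h2
  refine h1.unique ?_
  rw [hasDerivAt_iff_isLittleO, Asymptotics.isLittleO_iff]
  intro η hη
  -- The `+ 1` allows `v = 0`.
  have hη' : 0 < η / (‖v‖ + 1) := by positivity
  filter_upwards [hline.eventually (hest hη')] with ε hε
  have h3 := hε (by rw [add_sub_cancel_left, map_smul, hv, smul_comm])
  simp only [add_sub_cancel_left, zero_smul, add_zero, hfix, sub_zero] at h3 ⊢
  rw [smul_comm]
  refine h3.trans ?_
  rw [norm_smul, div_mul_eq_mul_div, div_le_iff₀ (by positivity)]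
  have := mul_nonneg hη.le (norm_nonneg ε)
  nlinarith

end ODE

/-! ### Metric and gradient in a chart -/

variable {n : ℕ} {M : Type*} [TopologicalSpace M] [ChartedSpace (EuclideanSpace ℝ (Fin n)) M]
  [IsManifold (𝓡 n) ∞ M]

/-- The metric `g` in the preferred chart at `p`, as a bilinear form depending on the
coordinates. -/
def metricInChart (g : Metric n M) (p : M) (y : EuclideanSpace ℝ (Fin n)) :
    EuclideanSpace ℝ (Fin n) →L[ℝ] EuclideanSpace ℝ (Fin n) →L[ℝ] ℝ :=
  ContinuousLinearMap.inCoordinates (EuclideanSpace ℝ (Fin n)) (TangentSpace (𝓡 n))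
    (EuclideanSpace ℝ (Fin n) →L[ℝ] ℝ) (fun x : M => TangentSpace (𝓡 n) x →L[ℝ] ℝ)
    p ((extChartAt (𝓡 n) p).symm y) p ((extChartAt (𝓡 n) p).symm y)
    (g.inner ((extChartAt (𝓡 n) p).symm y))

/-- The gradient of `f` in the preferred chart at `p`. -/
def gradInChart (g : Metric n M) (f : M → ℝ) (p : M) (y : EuclideanSpace ℝ (Fin n)) :
    EuclideanSpace ℝ (Fin n) :=
  tangentCoordChange (𝓡 n) ((extChartAt (𝓡 n) p).symm y) p ((extChartAt (𝓡 n) p).symm y)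
    (grad g f ((extChartAt (𝓡 n) p).symm y))

theorem contDiffAt_metricInChart (g : Metric n M) (p : M) :
    ContDiffAt ℝ ∞ (metricInChart g p) (extChartAt (𝓡 n) p p) := by
  have h1 := ((contMDiffAt_hom_bundle _).1 (g.contMDiff p)).2
  rw [contMDiffAt_iff_source] at h1
  simpa [contMDiffWithinAt_univ, contMDiffAt_iff_contDiffAt] using! h1

theorem metricInChart_apply (g : Metric n M) (p : M) {q : M}
    (hq : q ∈ (chartAt (EuclideanSpace ℝ (Fin n)) p).source) (a b : EuclideanSpace ℝ (Fin n)) :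
    metricInChart g p (extChartAt (𝓡 n) p q) a b =
      g.inner q ((trivializationAt (EuclideanSpace ℝ (Fin n)) (TangentSpace (𝓡 n)) p).symmL ℝ q a)
        ((trivializationAt (EuclideanSpace ℝ (Fin n)) (TangentSpace (𝓡 n)) p).symmL ℝ q b) := by
  have hq' : (extChartAt (𝓡 n) p).symm (extChartAt (𝓡 n) p q) = q :=
    (extChartAt (𝓡 n) p).left_inv (by rwa [extChartAt_source])
  rw [metricInChart, hq', inCoordinates_apply_eq₂ (by simpa using hq)
    (by simpa using hq) (by simp)]
  have hs : ∀ c : EuclideanSpace ℝ (Fin n),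
      (trivializationAt (EuclideanSpace ℝ (Fin n)) (TangentSpace (𝓡 n)) p).symmL ℝ q c =
        (trivializationAt (EuclideanSpace ℝ (Fin n)) (TangentSpace (𝓡 n)) p).symm q c := fun c =>
    Bundle.Trivialization.symmL_apply _ (by simpa using hq) c
  rw [hs, hs]
  simp

theorem metricInChart_self (g : Metric n M) (p : M) (a b : EuclideanSpace ℝ (Fin n)) :
    metricInChart g p (extChartAt (𝓡 n) p p) a b = g.inner p a b := by
  have h : ∀ a : EuclideanSpace ℝ (Fin n),
      (trivializationAt (EuclideanSpace ℝ (Fin n)) (TangentSpace (𝓡 n)) p).symmL ℝ p a = a := by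
    intro a
    rw [TangentBundle.symmL_trivializationAt_eq_core (mem_chart_source _ p)]
    exact (tangentBundleCore (𝓡 n) M).coordChange_self _ _ (mem_chart_source _ p) a
  rw [metricInChart_apply g p (mem_chart_source _ p), h, h]

/-- The cocycle identity: changing from the chart at `q` to the chart at `p` and back is the
identity. -/
theorem symmL_tangentCoordChange (p : M) {q : M}
    (hq : q ∈ (chartAt (EuclideanSpace ℝ (Fin n)) p).source) (v : TangentSpace (𝓡 n) q) :
    (trivializationAt (EuclideanSpace ℝ (Fin n)) (TangentSpace (𝓡 n)) p).symmL ℝ q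
      (tangentCoordChange (𝓡 n) q p q v) = v := by
  rw [TangentBundle.symmL_trivializationAt_eq_core hq]
  have h := (tangentBundleCore (𝓡 n) M).coordChange_comp (achart _ q) (achart _ p) (achart _ q) q
    ⟨⟨mem_chart_source _ q, hq⟩, mem_chart_source _ q⟩ v
  exact h.trans ((tangentBundleCore (𝓡 n) M).coordChange_self _ _ (mem_chart_source _ q) v)

/-- The coordinate form of `g(∇f, ·) = df`: a linear system with smooth data, from which the
gradient inherits differentiability and its linearization. -/
theorem metricInChart_gradInChart (g : Metric n M) {f : M → ℝ} {p : M}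
    (hf : ContMDiff (𝓡 n) 𝓘(ℝ, ℝ) ∞ f) {y : EuclideanSpace ℝ (Fin n)}
    (hy : y ∈ (extChartAt (𝓡 n) p).target) :
    metricInChart g p y (gradInChart g f p y) =
      fderiv ℝ (f ∘ (extChartAt (𝓡 n) p).symm) y := by
  obtain ⟨q, hq, rfl⟩ : ∃ q ∈ (extChartAt (𝓡 n) p).source, extChartAt (𝓡 n) p q = y :=
    ⟨_, (extChartAt (𝓡 n) p).map_target hy, (extChartAt (𝓡 n) p).right_inv hy⟩
  have hq' : (extChartAt (𝓡 n) p).symm (extChartAt (𝓡 n) p q) = q :=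
    (extChartAt (𝓡 n) p).left_inv hq
  have hqc : q ∈ (chartAt (EuclideanSpace ℝ (Fin n)) p).source := by
    rwa [extChartAt_source] at hq
  ext b
  rw [metricInChart_apply g p hqc, gradInChart, hq', symmL_tangentCoordChange p hqc, inner_grad,
    TangentBundle.symmL_trivializationAt hqc, ← mfderiv_eq_fderiv]
  have h1 : MDifferentiableAt (𝓡 n) 𝓘(ℝ, ℝ) f ((extChartAt (𝓡 n) p).symm (extChartAt (𝓡 n) p q)) :=
    (hf _).mdifferentiableAt (by simp)
  have h2 : MDifferentiableAt 𝓘(ℝ, EuclideanSpace ℝ (Fin n)) (𝓡 n) (extChartAt (𝓡 n) p).symm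
      (extChartAt (𝓡 n) p q) := by
    have := mdifferentiableWithinAt_extChartAt_symm (I := 𝓡 n) hy
    simpa [mdifferentiableWithinAt_univ] using this
  -- Taking `u` in the model space allows a change of base point without transporting vectors
  -- between tangent spaces.
  have h3 : ∀ q', q' = q → ∀ u : EuclideanSpace ℝ (Fin n),
      (mfderiv (𝓡 n) 𝓘(ℝ, ℝ) f q' u : ℝ) = mfderiv (𝓡 n) 𝓘(ℝ, ℝ) f q u := by
    rintro _ rfl u
    rfl
  rw [mfderiv_comp _ h1 h2, modelWithCornersSelf_coe, range_id, mfderivWithin_univ]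
  exact (h3 _ hq' _).symm

/-- At a critical point `p` of `f`, the gradient of `f` has a linearization that is symmetric for
the metric. -/
theorem exists_hasFDerivAt_gradInChart (g : Metric n M) {f : M → ℝ} {p : M}
    (hf : ContMDiff (𝓡 n) 𝓘(ℝ, ℝ) ∞ f) (hp : gradInChart g f p (extChartAt (𝓡 n) p p) = 0) :
    ∃ L : EuclideanSpace ℝ (Fin n) →L[ℝ] EuclideanSpace ℝ (Fin n),
      HasFDerivAt (gradInChart g f p) L (extChartAt (𝓡 n) p p) ∧
      ∀ v w : EuclideanSpace ℝ (Fin n), g.inner p (L v) w = g.inner p v (L w) := by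
  set x₀ := extChartAt (𝓡 n) p p with hx₀
  set G := metricInChart g p with hG
  set F := f ∘ (extChartAt (𝓡 n) p).symm with hF
  have hFs : ContDiffAt ℝ ∞ F x₀ := by
    have h1 := (contMDiffAt_iff_source.1 (hf p))
    simpa [contMDiffWithinAt_univ, contMDiffAt_iff_contDiffAt] using! h1
  have hGs : ContDiffAt ℝ ∞ G x₀ := contDiffAt_metricInChart g p
  have hinj : Function.Injective (G x₀) := by
    refine (injective_iff_map_eq_zero _).2 fun v hv => ?_
    by_contra hne
    refine (g.pos p v hne).ne' ?_
    rw [← metricInChart_self g p v v, ← hx₀, ← hG, hv]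
    rfl
  have hinv : (G x₀).IsInvertible := by
    have hfin : Module.finrank ℝ (EuclideanSpace ℝ (Fin n)) =
        Module.finrank ℝ (EuclideanSpace ℝ (Fin n) →L[ℝ] ℝ) := by
      rw [← (LinearMap.toContinuousLinearMap (𝕜 := ℝ) (E := EuclideanSpace ℝ (Fin n))
        (F' := ℝ)).finrank_eq]
      exact Subspace.dual_finrank_eq.symm
    exact ⟨(LinearEquiv.ofInjectiveOfFinrankEq (G x₀).toLinearMap hinj
      hfin).toContinuousLinearEquiv, by ext; rfl⟩
  have hFd : ContDiffAt ℝ ∞ (fderiv ℝ F) x₀ := hFs.fderiv_right (m := ∞) (by simp)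
  have heq : ∀ᶠ y in 𝓝 x₀, G y (gradInChart g f p y) = fderiv ℝ F y := by
    filter_upwards [extChartAt_target_mem_nhds (I := 𝓡 n) p] with y hy
    exact metricInChart_gradInChart g hf hy
  have hinv' : ∀ᶠ y in 𝓝 x₀, (G y).IsInvertible :=
    hGs.continuousAt.eventually ((ContinuousLinearEquiv.isOpen).mem_nhds hinv)
  have hgrad : gradInChart g f p =ᶠ[𝓝 x₀] fun y => (G y).inverse (fderiv ℝ F y) := by
    filter_upwards [heq, hinv'] with y hy hi
    rw [← hy]
    obtain ⟨e, he⟩ := hi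
    rw [← he]
    simp
  have hdiff : DifferentiableAt ℝ (gradInChart g f p) x₀ := by
    have h1 : ContDiffAt ℝ ∞ (fun y => (G y).inverse (fderiv ℝ F y)) x₀ :=
      (hinv.contDiffAt_map_inverse.comp x₀ hGs).clm_apply hFd
    exact (h1.differentiableAt (by simp)).congr_of_eventuallyEq hgrad
  refine ⟨_, hdiff.hasFDerivAt, ?_⟩
  set L := fderiv ℝ (gradInChart g f p) x₀
  -- Differentiate `G ∇f = dF`: the term with the derivative of `G` drops out because `∇f` vanishes
  -- at `x₀`, leaving the second derivative of `F`.
  have hD : ∀ v w, G x₀ (L v) w = fderiv ℝ (fderiv ℝ F) x₀ v w := by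
    intro v w
    have h1 := (hGs.differentiableAt (by simp)).hasFDerivAt.clm_apply hdiff.hasFDerivAt
    have h2 : HasFDerivAt (fun y => G y (gradInChart g f p y)) (fderiv ℝ (fderiv ℝ F) x₀) x₀ :=
      (hFd.differentiableAt (by simp)).hasFDerivAt.congr_of_eventuallyEq heq
    rw [← h1.unique h2]
    simp [hp, L]
  have hsymm : IsSymmSndFDerivAt ℝ F x₀ := hFs.isSymmSndFDerivAt (by
    rw [minSmoothness_of_isRCLikeNormedField]
    exact WithTop.coe_le_coe.2 (le_top : (2 : ℕ∞) ≤ ⊤))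
  intro v w
  calc g.inner p (L v) w = G x₀ (L v) w := (metricInChart_self g p _ _).symm
    _ = G x₀ (L w) v := by rw [hD, hD]; exact hsymm v w
    _ = g.inner p (L w) v := metricInChart_self g p _ _
    _ = g.inner p v (L w) := g.symm p _ _

/-- An integral curve of `-∇f`, in the preferred chart at `p`. -/
theorem hasDerivWithinAt_chart_of_isMIntegralCurveOn {g : Metric n M} {f : M → ℝ} {γ : ℝ → M}
    {s : Set ℝ} (hγ : IsMIntegralCurveOn γ (fun y => -grad g f y) s) (p : M) {t : ℝ} (ht : t ∈ s)
    (hsrc : γ t ∈ (chartAt (EuclideanSpace ℝ (Fin n)) p).source) :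
    HasDerivWithinAt (fun r => chartAt (EuclideanSpace ℝ (Fin n)) p (γ r))
      (-gradInChart g f p (chartAt (EuclideanSpace ℝ (Fin n)) p (γ t))) s t := by
  have hq : (extChartAt (𝓡 n) p).symm (chartAt (EuclideanSpace ℝ (Fin n)) p (γ t)) = γ t :=
    (extChartAt (𝓡 n) p).left_inv (by rwa [extChartAt_source])
  have hD : HasDerivWithinAt (extChartAt (𝓡 n) p ∘ γ)
      (tangentCoordChange (𝓡 n) (γ t) p (γ t) (-grad g f (γ t))) s t := by
    let w : EuclideanSpace ℝ (Fin n) := -grad g f (γ t)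
    have hF : HasFDerivWithinAt (extChartAt (𝓡 n) p ∘ γ)
        ((tangentCoordChange (𝓡 n) (γ t) p (γ t)).comp ((1 : ℝ →L[ℝ] ℝ).smulRight w)) s t := by
      have h1 := (hasMFDerivWithinAt_extChartAt (I := 𝓡 n) hsrc).comp t (hγ _ ht)
        (Set.subset_preimage_image _ _)
      rw [mfderiv_chartAt_eq_tangentCoordChange hsrc] at h1
      exact hasMFDerivWithinAt_iff_hasFDerivWithinAt.1 h1
    have h2 := hF.hasDerivWithinAt
    simp only [ContinuousLinearMap.comp_apply, ContinuousLinearMap.smulRight_apply,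
      one_apply_eq_self, one_smul] at h2
    exact h2
  have hval : -gradInChart g f p (chartAt (EuclideanSpace ℝ (Fin n)) p (γ t)) =
      tangentCoordChange (𝓡 n) (γ t) p (γ t) (-grad g f (γ t)) := by
    rw [gradInChart, hq]
    exact (map_neg (tangentCoordChange (𝓡 n) (γ t) p (γ t)) (grad g f (γ t))).symm
  rw [hval]
  exact hD

/-! ### The soliton at an equilibrium -/

namespace IsGradientRicciSoliton

variable {g : ℝ → Metric n M} {ρ : ℝ} {f : M → ℝ} {φ : ℝ → M ≃ₘ⟮𝓡 n, 𝓡 n⟯ M}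

/-- The trajectory of `p` is constant, so its one-sided derivative at time zero is both `0` and
`-∇f(p)`. -/
theorem gradInChart_eq_zero (hsol : IsGradientRicciSoliton g ρ f φ) {p : M}
    (hp : ∀ t : ℝ, 0 ≤ t → φ t p = p) :
    gradInChart (g 0) f p (extChartAt (𝓡 n) p p) = 0 := by
  have h1 := hasDerivWithinAt_chart_of_isMIntegralCurveOn (hsol.flow p) p
    (mem_Ici.2 (le_refl (0 : ℝ))) (by simp [hp 0 le_rfl])
  have h2 : HasDerivWithinAt (fun t => chartAt (EuclideanSpace ℝ (Fin n)) p (φ t p)) 0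
      (Ici 0) 0 :=
    (hasDerivWithinAt_const (0 : ℝ) (Ici 0) (chartAt (EuclideanSpace ℝ (Fin n)) p p)).congr
      (fun t ht => by rw [hp t ht]) (by rw [hp 0 le_rfl])
  have h3 := (uniqueDiffOn_Ici (0 : ℝ) 0 self_mem_Ici).eq_deriv _ h1 h2
  simp only [hp 0 le_rfl, neg_eq_zero] at h3
  exact h3

/-- At an equilibrium `p`, the metrics `g(t)` are determined by the eigenvectors of a linear map
that is symmetric for `g(0)`. -/
theorem exists_linearization [T2Space M] (hsol : IsGradientRicciSoliton g ρ f φ) {p : M}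
    (hp : ∀ t : ℝ, 0 ≤ t → φ t p = p) :
    ∃ L : EuclideanSpace ℝ (Fin n) →L[ℝ] EuclideanSpace ℝ (Fin n),
      (∀ v w : EuclideanSpace ℝ (Fin n), (g 0).inner p (L v) w = (g 0).inner p v (L w)) ∧
      ∀ (c d : ℝ) (v w : EuclideanSpace ℝ (Fin n)), L v = c • v → L w = d • w → ∀ t, 0 ≤ t →
        (g t).inner p v w = Real.exp (c * t) * Real.exp (d * t) * (g 0).inner p v w := by
  have hz := hsol.gradInChart_eq_zero hp
  obtain ⟨L, hL, hsymm⟩ := exists_hasFDerivAt_gradInChart (g 0) hsol.smooth_potential hz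
  refine ⟨-L, fun v w => ?_, fun c d v w hv hw t ht => ?_⟩
  · have h1 : (g 0).inner p ((-L) v) w = -(g 0).inner p (L v) w := by
      exact congrArg (fun B => B w) (map_neg ((g 0).inner p) (L v))
    have h2 : (g 0).inner p v ((-L) w) = -(g 0).inner p v (L w) :=
      map_neg ((g 0).inner p v) (L w)
    rw [h1, h2, hsymm]
  · have hA := ((φ t).contMDiff.mdifferentiableAt (x := p) (by simp)).hasMFDerivAt.2
    set A : EuclideanSpace ℝ (Fin n) →L[ℝ] EuclideanSpace ℝ (Fin n) :=
      mfderiv (𝓡 n) (𝓡 n) (φ t) p with hAdef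
    -- Since `φ t` fixes `p`, one chart serves for both source and target.
    have hA' : HasFDerivAt (fun y => chartAt (EuclideanSpace ℝ (Fin n)) p
        (φ t ((chartAt (EuclideanSpace ℝ (Fin n)) p).symm y))) A
        (chartAt (EuclideanSpace ℝ (Fin n)) p p) := by
      simp only [writtenInExtChartAt, hp t ht, modelWithCornersSelf_coe, range_id] at hA
      exact hasFDerivWithinAt_univ.1 hA
    have hev := fun {c : ℝ} {v : EuclideanSpace ℝ (Fin n)} (hv : (-L) v = c • v) =>
      fderiv_flow_apply_eigenvector (chartAt (EuclideanSpace ℝ (Fin n)) p)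
        (mem_chart_target _ p) (Φ := fun t x => φ t x) hsol.flow_zero
        (fun x => (hsol.flow x).continuousOn) (X := fun y => -gradInChart (g 0) f p y) (L := -L)
        hL.neg (neg_eq_zero.2 hz)
        (fun x t ht hsrc => hasDerivWithinAt_chart_of_isMIntegralCurveOn (hsol.flow x) p ht hsrc)
        ht hA' hv
    have hcongr : ∀ q, q = p → ∀ a b : EuclideanSpace ℝ (Fin n),
        (g 0).inner q a b = (g 0).inner p a b := by
      rintro _ rfl a b
      rfl
    have h1 : (g t).inner p v w = (g 0).inner p (A v) (A w) :=
      (hsol.pullback t ht p v w).trans (hcongr _ (hp t ht) (A v) (A w))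
    rw [h1, hev hv, hev hw]
    have h2 : (g 0).inner p (Real.exp (c * t) • v) = Real.exp (c * t) • (g 0).inner p v :=
      map_smul ((g 0).inner p) _ _
    have h3 : (g 0).inner p v (Real.exp (d * t) • w) = Real.exp (d * t) • (g 0).inner p v w :=
      map_smul ((g 0).inner p v) _ _
    rw [h2, mul_assoc, ← smul_eq_mul (Real.exp (d * t)), ← h3]
    rfl

end IsGradientRicciSoliton

/-! ### Comparison of exponential rates and conclusion -/

/-- If `a_k e^{b t_k}` and `a_k e^{c t_k}` have positive limits, where `t_k → ∞`, then `b = c`. -/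
theorem eq_of_tendsto_mul_exp {t a : ℕ → ℝ} (ht : Tendsto t atTop atTop) {b c x y : ℝ}
    (hx : 0 < x) (hy : 0 < y) (hb : Tendsto (fun k => a k * Real.exp (b * t k)) atTop (𝓝 x))
    (hc : Tendsto (fun k => a k * Real.exp (c * t k)) atTop (𝓝 y)) : b = c := by
  wlog h : b ≤ c generalizing b c x y
  · exact (this hy hx hc hb (le_of_not_ge h)).symm
  rcases h.eq_or_lt with h | h
  · exact h
  -- If `b < c`, the first sequence is the second times a factor tending to `0`, contradicting `x >
  -- 0`.
  have h0 : Tendsto (fun k => Real.exp ((b - c) * t k)) atTop (𝓝 0) :=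
    Real.tendsto_exp_atBot.comp (ht.const_mul_atTop_of_neg (sub_neg.2 h))
  have h1 := hc.mul h0
  rw [mul_zero] at h1
  refine absurd (tendsto_nhds_unique hb (h1.congr fun k => ?_)) hx.ne'
  rw [mul_assoc, ← Real.exp_add]
  congr 2
  ring

end RicciSoliton

end

open RicciSoliton in
theorem theorem2p1 {n : ℕ} {M : Type*} [TopologicalSpace M] [T2Space M]
    [SecondCountableTopology M] [ChartedSpace (EuclideanSpace ℝ (Fin n)) M]
    [IsManifold (𝓡 n) ∞ M]
    (g : ℝ → Metric n M) (ρ : ℝ) (f : M → ℝ) (φ : ℝ → M ≃ₘ⟮𝓡 n, 𝓡 n⟯ M)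
    (hsol : IsGradientRicciSoliton g ρ f φ)
    (p : M) (hp : ∀ t : ℝ, 0 ≤ t → φ t p = p)
    (t : ℕ → ℝ) (ht : Tendsto t atTop atTop)
    (σ : ℕ → ℝ) (hσ : ∀ k, 0 < σ k)
    (U : Set M) (hU : U ∈ 𝓝 p)
    (h : ∀ x : M, TangentSpace (𝓡 n) x →L[ℝ] TangentSpace (𝓡 n) x →L[ℝ] ℝ)
    (hh : IsRiemannianMetricOn h U)
    (hconv : TendstoUniformlyOnSet (g 0) (fun k x => σ k • (g (t k)).inner x) h U) :
    ∃ β : ℝ, ∀ v w : TangentSpace (𝓡 n) p,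
      ricci (g 0) p v w = β * (g 0).inner p v w := by
  obtain ⟨L, hsymm, hL⟩ := hsol.exists_linearization hp
  have hpU : p ∈ U := mem_of_mem_nhds hU
  have hlim : ∀ v : TangentSpace (𝓡 n) p,
      Tendsto (fun k => σ k * (g (t k)).inner p v v) atTop (𝓝 (h p v v)) := fun v => by
    rw [Metric.tendsto_nhds]
    intro ε hε
    set N := Real.sqrt ((g 0).inner p v v) with hN
    have hN0 : 0 ≤ N := Real.sqrt_nonneg _
    filter_upwards [hconv (ε / (N * N + 1)) (by positivity)] with k hk
    refine (hk p hpU v v).trans_lt ?_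
    rw [← hN, mul_assoc, div_mul_eq_mul_div, div_lt_iff₀ (by positivity)]
    linarith
  have hev : ∀ v : TangentSpace (𝓡 n) p, v ≠ 0 → ∀ c : ℝ, L v = c • v →
      ∃ x, 0 < x ∧ Tendsto (fun k => σ k * Real.exp (2 * c * t k)) atTop (𝓝 x) := by
    intro v hv c hc
    have hpos : 0 < (g 0).inner p v v := (g 0).pos p v hv
    refine ⟨h p v v / (g 0).inner p v v, div_pos (hh.pos p hpU v hv) hpos, ?_⟩
    refine ((hlim v).div_const _).congr' ?_
    -- The exponential formula for `g(t)` is available only for `t ≥ 0`.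
    filter_upwards [ht.eventually_ge_atTop 0] with k hk
    rw [hL c c v v hc hc (t k) hk, ← Real.exp_add, ← mul_assoc,
      mul_div_assoc, div_self hpos.ne', mul_one]
    congr 2
    ring
  obtain ⟨c, hc⟩ := exists_eq_smul_of_symmetric_of_unique_eigenvalue
    (V := TangentSpace (𝓡 n) p) (bilinAt (g 0) p) (fun v w => (g 0).symm p v w)
    (fun v hv => (g 0).pos p v hv) L.toLinearMap hsymm fun a b v w hv hw ha hb => by
      obtain ⟨x, hx, hxlim⟩ := hev v hv a ha
      obtain ⟨y, hy, hylim⟩ := hev w hw b hb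
      linarith [eq_of_tendsto_mul_exp ht hx hy hxlim hylim]
  -- The value comes from equating the two derivatives at `t = 0`: `-2 Ric - 2ρ g = 2c g`.
  refine ⟨-c - ρ, fun v w => ?_⟩
  have h1 := hsol.ricci_flow 0 le_rfl p v w
  have h2 : HasDerivWithinAt (fun s => (g s).inner p v w) (2 * c * (g 0).inner p v w)
      (Ici 0) 0 := by
    have h3 : HasDerivAt (fun s : ℝ => Real.exp (c * s) * Real.exp (c * s) * (g 0).inner p v w)
        (2 * c * (g 0).inner p v w) 0 := by
      have h4 : HasDerivAt (fun s : ℝ => Real.exp (c * s)) (Real.exp (c * 0) * (c * 1)) 0 :=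
        ((hasDerivAt_id (0 : ℝ)).const_mul c).exp
      refine ((h4.mul h4).mul_const ((g 0).inner p v w)).congr_deriv ?_
      simp only [mul_zero, Real.exp_zero]
      ring
    exact h3.hasDerivWithinAt.congr (fun s hs => hL c c v w (hc v) (hc w) s hs)
      (hL c c v w (hc v) (hc w) 0 le_rfl)
  have h5 := (uniqueDiffOn_Ici (0 : ℝ) 0 self_mem_Ici).eq_deriv _ h1 h2
  linarith
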